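/- Assume the continuum hypothesis $2^{\aleph_0}=\aleph_1$. Let $K$ be a nonmetrizable compact Hausdorff space that is scattered (no nonempty subset of $K$ is dense-in-itself) and has finite height, i.e. the $n$-th Cantor–Bendixson derivative $K^{(n)}$ is empty for some $n\in\mathbb{N}$. Let $C(K)$ be the Banach space of real-valued continuous functions on $K$ with the supremum norm. Then there is a nontrivial twisted sum of $c_0$ and $C(K)$: there exist a real Banach space $X$ and bounded linear operators $i:c_0\to X$ and $q:X\to C(K)$ such that \[0\to c_0\xrightarrow{\ i\ } X\xrightarrow{\ q\ } C(K)\to 0\] is exact and does not split, i.e. there is no bounded linear operator $r:X\to c_0$ with $r\circ i=\mathrm{id}_{c_0}$. -/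

import Mathlib

universe u

/-- The Banach space `c₀` of real sequences converging to `0`, with the supremum norm
(continuous functions on the discrete space `ℕ` that vanish at infinity). -/
abbrev SeqC0 : Type := ZeroAtInftyContinuousMap ℕ ℝ

/-- A space is scattered if no nonempty subset of it is dense-in-itself. -/
def IsScatteredSpace (X : Type u) [TopologicalSpace X] : Prop :=
  ∀ A : Set X, A.Nonempty → ¬ Preperfect A

/-- The scattered height of `X`: the least ordinal `α` such that the `α`-th Cantor-Bendixson
derivative of `X` is empty. -/
noncomputable def scatteredHeight (X : Type u) [TopologicalSpace X] : Ordinal.{u} :=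
  sInf {α : Ordinal.{u} | CantorBendixson.iteratedDerivedSet (Set.univ : Set X) α = ∅}

/-- In a scattered space the infimum defining the height is over a nonempty set, so the
derivative at the height is indeed empty. -/
theorem iteratedDerivedSet_scatteredHeight {X : Type u} [TopologicalSpace X]
    (h : IsScatteredSpace X) :
    CantorBendixson.iteratedDerivedSet (Set.univ : Set X) (scatteredHeight X) = ∅ := by
  have hne : {α : Ordinal.{u} |
      CantorBendixson.iteratedDerivedSet (Set.univ : Set X) α = ∅}.Nonempty := by
    obtain ⟨a, ha⟩ := CantorBendixson.iteratedDerivedSet_mem_fixedPoints (Set.univ : Set X)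
    refine ⟨a, ?_⟩
    by_contra hne
    exact h _ (Set.nonempty_iff_ne_empty.mpr hne)
      (preperfect_iff_eq_relDerivedSet.mpr (Function.mem_fixedPoints_iff.mp ha).symm)
  exact csInf_mem hne

section TwistedSum

variable {Z X Y : Type*} [NormedAddCommGroup Z] [NormedSpace ℝ Z]
  [NormedAddCommGroup X] [NormedSpace ℝ X] [NormedAddCommGroup Y] [NormedSpace ℝ Y]

/-- `0 → Z → X → Y → 0` with maps `i` and `q` is a short exact sequence of bounded linear
operators. For Banach spaces `Z`, `X`, `Y` this is a twisted sum of `Z` and `Y`. -/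
structure IsTwistedSum (i : Z →L[ℝ] X) (q : X →L[ℝ] Y) : Prop where
  injective : Function.Injective i
  exact : Function.Exact i q
  surjective : Function.Surjective q

/-- The twisted sum (short exact sequence) starting with `i : Z → X` is trivial (splits): `i` has a bounded linear left
inverse. -/
def IsSplitTwistedSum (i : Z →L[ℝ] X) : Prop :=
  ∃ r : X →L[ℝ] Z, r.comp i = ContinuousLinearMap.id ℝ Z

end TwistedSum

/-! ### Convergent uncountable sets in scattered compacta -/

open Set Filter Topology

/-! The argument counts splittings. A nonmetrizable `K` is uncountable, so it has a last uncountable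
derivative, and inside it an uncountable set `Z` converging to a point `p`. By CH, `Z` contains
distinct points `z α` indexed by the branches `α` of the binary tree, whose codes `A α` form an
almost disjoint family in `ℕ`.

For each set `S` of branches, let `X_S` consist of the pairs `(f, v)` with `v` bounded, `v → f (z α)
- f p` along `A α` for `α ∈ S`, and `v` small off finite unions of these `A α`. Each `X_S` is a
twisted sum of `c₀` and `C(K)` (`isTwistedSum_gluing`).

A splitting of `X_S` yields functionals `φ n` on `C(K)` such that `(f, (φ n f)ₙ)` lies in `X_S` for
every `f`. Testing on functions `f α` that are 1 at `z α` and 0 at `p` and the other `z β` recovers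
`S`: `φ n (f α) → 0` iff `α ∉ S`. Finite height makes each `φ n` a countable sum of point masses,
and points of `K` matter only through their values under the `f α`, of which there are at most `𝔠`
patterns (`mk_range_eval_le`). So at most `𝔠` sets `S` could be recovered, whereas there are `2 ^
𝔠`; some `X_S` does not split. -/

theorem finite_of_disjoint_derivedSet {K : Type*} [TopologicalSpace K] {C F : Set K}
    (hC : IsCompact C) (hCF : C ⊆ F) (hd : ∀ x ∈ C, x ∉ derivedSet F) : C.Finite := by
  by_contra h
  obtain ⟨x, hx, hacc⟩ := Set.Infinite.exists_accPt_of_subset_isCompact h hC subset_rfl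
  exact hd x hx (hacc.mono (principal_mono.mpr hCF))

theorem exists_isOpen_inter_subset_singleton {K : Type*} [TopologicalSpace K] {F : Set K} {x : K}
    (h : x ∉ derivedSet F) : ∃ V, IsOpen V ∧ x ∈ V ∧ V ∩ F ⊆ {x} := by
  rw [mem_derivedSet, accPt_iff_nhds] at h
  push Not at h
  obtain ⟨U, hU, hx⟩ := h
  obtain ⟨V, hVU, hV, hxV⟩ := mem_nhds_iff.mp hU
  exact ⟨V, hV, hxV, fun y hy => hx y ⟨hVU hy.1, hy.2⟩⟩

/-- One separating function per pair of points embeds `K` into a countable power of `ℝ`. -/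
theorem metrizableSpace_of_countable_compact {K : Type*} [TopologicalSpace K] [CompactSpace K]
    [T2Space K] [Countable K] : TopologicalSpace.MetrizableSpace K := by
  have h : ∀ p : K × K, ∃ f : C(K, ℝ), p.1 ≠ p.2 → f p.1 ≠ f p.2 := by
    intro p
    by_cases hp : p.1 = p.2
    · exact ⟨0, fun h => (h hp).elim⟩
    · obtain ⟨f, h0, h1, -⟩ := exists_continuous_zero_one_of_isClosed
        (isClosed_singleton (x := p.1)) (isClosed_singleton (x := p.2)) (by simpa using hp)
      refine ⟨f, fun _ => ?_⟩
      rw [h0 rfl, h1 rfl]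
      simp
  choose f hf using h
  have hcont : Continuous fun (x : K) (p : K × K) => f p x :=
    continuous_pi fun p => (f p).continuous
  have hinj : Function.Injective fun (x : K) (p : K × K) => f p x := by
    intro x y hxy
    by_contra hne
    exact hf (x, y) hne (congrFun hxy (x, y))
  exact (hcont.isClosedEmbedding hinj).isEmbedding.metrizableSpace

/-- A closed subset of a scattered compact space that is uncountable but has countable derived set
contains an uncountable set converging to a point. -/
theorem exists_uncountable_converging {K : Type*} [TopologicalSpace K] [CompactSpace K] [T2Space K]
    (hsc : IsScatteredSpace K) {F : Set K} (hF : IsClosed F) (hunc : ¬ F.Countable)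
    (hcount : (derivedSet F).Countable) :
    ∃ (p : K) (Z : Set K), ¬ Z.Countable ∧ p ∉ Z ∧
      ∀ O, IsOpen O → p ∈ O → (Z \ O).Finite := by
  -- The condensation points of `F`. Scatteredness supplies a point `p` isolated in `B`.
  set B : Set K := {y | ∀ U, IsOpen U → y ∈ U → ¬ (U ∩ F).Countable} with hB
  have hBne : B.Nonempty := by
    by_contra hne
    have hall : ∀ y : K, ∃ U, IsOpen U ∧ y ∈ U ∧ (U ∩ F).Countable := by
      intro y
      by_contra hy
      push Not at hy
      exact hne ⟨y, hy⟩
    choose U hU hyU hUc using hall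
    obtain ⟨t, ht⟩ := isCompact_univ.elim_finite_subcover U hU
      (fun y _ => mem_iUnion.mpr ⟨y, hyU y⟩)
    apply hunc
    refine (t.countable_toSet.biUnion (fun y _ => hUc y)).mono fun x hx => ?_
    obtain ⟨y, hy, hxy⟩ := mem_iUnion₂.mp (ht (mem_univ x))
    exact mem_biUnion hy ⟨hxy, hx⟩
  have hnp := hsc B hBne
  rw [preperfect_iff_subset_derivedSet, not_subset] at hnp
  obtain ⟨p, hpB, hpd⟩ := hnp
  obtain ⟨U, hU, hpU, hUB⟩ := exists_isOpen_inter_subset_singleton hpd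
  obtain ⟨N, hNn, hNc, hNU⟩ := exists_mem_nhds_isClosed_subset (hU.mem_nhds hpU)
  have hsmall : ∀ y : K, ∃ V, IsOpen V ∧ (y ∉ B → y ∈ V ∧ (V ∩ F).Countable) := by
    intro y
    by_cases hy : y ∈ B
    · exact ⟨∅, isOpen_empty, fun h => (h hy).elim⟩
    · simp only [hB, mem_ofPred_eq] at hy
      push Not at hy
      obtain ⟨V, hV, hyV, hc⟩ := hy
      exact ⟨V, hV, fun _ => ⟨hyV, hc⟩⟩
  choose V hVo hV using hsmall
  set D : Set K := (N ∩ derivedSet F) \ {p} with hD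
  have hDc : D.Countable := hcount.mono fun x hx => hx.1.2
  have hDB : ∀ y ∈ D, y ∉ B := fun y hy hyB => hy.2 (hUB ⟨hNU hy.1.1, hyB⟩)
  -- Near `p`, the other accumulation points of `F` are countably many and not in `B`; deleting
  -- neighbourhoods with countable trace on `F` leaves an uncountable set that can accumulate only
  -- at `p`.
  set C : Set K := (N ∩ F) \ ⋃ y ∈ D, V y with hC
  have hCc : IsClosed C :=
    (hNc.inter hF).sdiff (isOpen_biUnion fun y _ => hVo y)
  have hCunc : ¬ C.Countable := by
    intro h
    obtain ⟨O, hON, hO, hpO⟩ := mem_nhds_iff.mp hNn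
    apply hpB O hO hpO
    refine (h.union (hDc.biUnion fun y hy => (hV y (hDB y hy)).2)).mono fun x hx => ?_
    by_cases hxV : x ∈ ⋃ y ∈ D, V y
    · obtain ⟨y, hy, hxy⟩ := mem_iUnion₂.mp hxV
      exact Or.inr (mem_biUnion hy ⟨hxy, hx.2⟩)
    · exact Or.inl ⟨⟨hON hx.1, hx.2⟩, hxV⟩
  refine ⟨p, C \ {p}, fun h => hCunc ?_, fun h => h.2 rfl, fun O hO hpO => ?_⟩
  · exact (h.union (countable_singleton p)).mono fun x hx => by
      by_cases hxp : x = p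
      · exact Or.inr hxp
      · exact Or.inl ⟨hx, hxp⟩
  · refine (finite_of_disjoint_derivedSet (C := C \ O) (F := F) (hCc.sdiff hO).isCompact
      (fun x hx => hx.1.1.2) fun x hx hxd => ?_).subset fun x hx => ⟨hx.1.1, hx.2⟩
    have hxp : x ≠ p := fun h => hx.2 (h ▸ hpO)
    have hxD : x ∈ D := ⟨⟨hx.1.1.1, hxd⟩, hxp⟩
    exact hx.1.2 (mem_biUnion hxD (hV x (hDB x hxD)).1)

theorem isClosed_insert_of_converging {K : Type*} [TopologicalSpace K] [T2Space K] {p : K}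
    {Z : Set K} (hZ : ∀ O, IsOpen O → p ∈ O → (Z \ O).Finite) {W : Set K} (hW : W ⊆ Z) :
    IsClosed (insert p W) := by
  rw [← isOpen_compl_iff, isOpen_iff_mem_nhds]
  intro w hw
  have hwp : w ≠ p := fun h => hw (Or.inl h)
  have hwW : w ∉ W := fun h => hw (Or.inr h)
  obtain ⟨U, O, hU, hO, hwU, hpO, hdis⟩ := t2_separation hwp
  have hfin : (W \ O).Finite := (hZ O hO hpO).subset (sdiff_subset_sdiff_left hW)
  refine mem_of_superset ((hU.sdiff hfin.isClosed).mem_nhds ⟨hwU, fun h => hwW h.1⟩) ?_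
  rintro x ⟨hxU, hx⟩ hxi
  have hxO : x ∉ O := fun h => disjoint_left.mp hdis hxU h
  rcases hxi with rfl | hxW
  · exact hxO hpO
  · exact hx ⟨hxW, hxO⟩

/-- A sequence of closed sets, each the derived set of the preceding one, from the whole space down
to the empty set. -/
structure IsFiniteDerivedSequence {K : Type*} [TopologicalSpace K] (F : ℕ → Set K) (N : ℕ) :
    Prop where
  zero : F 0 = univ
  succ : ∀ n, F (n + 1) = derivedSet (F n)
  closed : ∀ n, IsClosed (F n)
  last : F N = ∅

open Ordinal in
theorem exists_isFiniteDerivedSequence {K : Type*} [TopologicalSpace K]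
    (hsc : IsScatteredSpace K) (hht : scatteredHeight K < ω) :
    ∃ F N, IsFiniteDerivedSequence (K := K) F N := by
  obtain ⟨N, hN⟩ := lt_omega0.mp hht
  have hcl : ∀ a, IsClosed (CantorBendixson.iteratedDerivedSet (univ : Set K) a) :=
    CantorBendixson.isClosed_iteratedDerivedSet isClosed_univ
  refine ⟨fun n => CantorBendixson.iteratedDerivedSet univ (n : Ordinal), N, ?_, fun n => ?_,
    fun n => hcl _, ?_⟩
  · simp
  · rw [← (hcl n).relDerivedSet_eq, ← CantorBendixson.iteratedDerivedSet_succ]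
    simp
  · have := iteratedDerivedSet_scatteredHeight hsc
    rwa [hN] at this

theorem IsFiniteDerivedSequence.exists_uncountable_converging {K : Type*} [TopologicalSpace K]
    [CompactSpace K] [T2Space K] (hsc : IsScatteredSpace K) {F : ℕ → Set K} {N : ℕ}
    (hF : IsFiniteDerivedSequence F N) (hmet : ¬ TopologicalSpace.MetrizableSpace K) :
    ∃ (p : K) (Z : Set K), ¬ Z.Countable ∧ p ∉ Z ∧
      ∀ O, IsOpen O → p ∈ O → (Z \ O).Finite := by
  have h0 : ¬ (F 0).Countable := by
    rw [hF.zero, countable_univ_iff]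
    exact fun _ => hmet metrizableSpace_of_countable_compact
  obtain ⟨n, hn, hn1⟩ : ∃ n, ¬ (F n).Countable ∧ (F (n + 1)).Countable := by
    by_contra h
    push Not at h
    have : ∀ n, ¬ (F n).Countable := fun n => by
      induction n with
      | zero => exact h0
      | succ n ih => exact h n ih
    exact this N (by rw [hF.last]; exact countable_empty)
  rw [hF.succ] at hn1
  exact _root_.exists_uncountable_converging hsc (hF.closed n) hn hn1

/-! ### Atomic functionals and the number of evaluation patterns -/

section Functionals

variable {K : Type*} [TopologicalSpace K] [CompactSpace K]

/-- Truncating `g` to `[-ε, ε]` changes nothing on `F`, hence nothing in `φ g`. -/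
theorem abs_apply_le_of_abs_le_on {F : Set K} {φ : C(K, ℝ) →L[ℝ] ℝ}
    (hφ : ∀ f : C(K, ℝ), (∀ x ∈ F, f x = 0) → φ f = 0) {g : C(K, ℝ)} {ε : ℝ} (hε : 0 ≤ ε)
    (hg : ∀ x ∈ F, |g x| ≤ ε) : |φ g| ≤ ‖φ‖ * ε := by
  set h : C(K, ℝ) := ⟨fun x => max (-ε) (min ε (g x)), by fun_prop⟩ with hh
  have hgh : φ g = φ h := by
    rw [← sub_eq_zero, ← map_sub]
    refine hφ _ fun x hx => ?_
    have := abs_le.mp (hg x hx)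
    simp [hh, min_eq_right this.2, max_eq_right this.1]
  rw [hgh, ← Real.norm_eq_abs]
  refine (φ.le_opNorm h).trans (mul_le_mul_of_nonneg_left ?_ (norm_nonneg _))
  rw [ContinuousMap.norm_le _ hε]
  intro x
  rw [Real.norm_eq_abs, abs_le]
  exact ⟨le_max_left _ _, max_le (by linarith) (min_le_left _ _)⟩

theorem exists_indicator_on_isolated [T2Space K] {F : Set K} (hF : IsClosed F) (x : K) :
    ∃ u : C(K, ℝ), (∀ y ∈ F, y ≠ x → u y = 0) ∧ (x ∈ F → x ∉ derivedSet F → u x = 1) ∧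
      (∀ y ∈ F, y ∈ derivedSet F → u y = 0) := by
  by_cases hx : x ∈ derivedSet F
  · exact ⟨0, by simp, fun _ h => (h hx).elim, by simp⟩
  · obtain ⟨V, hV, hxV, hVF⟩ := exists_isOpen_inter_subset_singleton hx
    obtain ⟨u, h0, h1, -⟩ := exists_continuous_zero_one_of_isClosed
      (hF.sdiff hV) (isClosed_singleton (x := x)) (by
        rw [disjoint_singleton_right]
        exact fun h => h.2 hxV)
    have hu : ∀ y ∈ F, y ≠ x → u y = 0 := fun y hy hyx =>
      h0 ⟨hy, fun hyV => hyx (hVF ⟨hyV, hy⟩)⟩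
    exact ⟨u, hu, fun _ _ => h1 rfl, fun y hy hyd => hu y hy fun h => hx (h ▸ hyd)⟩

/-- On `F`, a function vanishing on the derived set is a uniform limit of finite combinations of
indicators `u x` of isolated points. The masses are `φ (u x)`. -/
theorem exists_hasSum_of_vanishing [T2Space K] {F : Set K} (hF : IsClosed F) {φ : C(K, ℝ) →L[ℝ] ℝ}
    (hφ : ∀ f : C(K, ℝ), (∀ x ∈ F, f x = 0) → φ f = 0) :
    ∃ a : K → ℝ, Summable (fun x => |a x|) ∧
      ∀ f : C(K, ℝ), (∀ x ∈ derivedSet F, f x = 0) → HasSum (fun x => a x * f x) (φ f) := by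
  classical
  choose u hu hu1 hud using exists_indicator_on_isolated hF
  have hcomb : ∀ (s : Finset K) (c : K → ℝ) (y : K), y ∈ F →
      (∑ x ∈ s, c x • u x) y = if y ∈ s ∧ y ∉ derivedSet F then c y else 0 := by
    intro s c y hy
    rw [ContinuousMap.sum_apply]
    simp only [ContinuousMap.smul_apply, smul_eq_mul]
    split_ifs with h
    · rw [Finset.sum_eq_single y]
      · rw [hu1 y hy h.2, mul_one]
      · intro x _ hx
        rw [hu x y hy hx.symm, mul_zero]
      · exact fun h' => (h' h.1).elim
    · refine Finset.sum_eq_zero fun x hx => ?_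
      by_cases hxy : y = x
      · subst hxy
        rw [hud y y hy (by_contra fun hd => h ⟨hx, hd⟩), mul_zero]
      · rw [hu x y hy hxy, mul_zero]
  have happ : ∀ (s : Finset K) (c : K → ℝ),
      φ (∑ x ∈ s, c x • u x) = ∑ x ∈ s, c x * φ (u x) := by
    intro s c
    simp [map_sum]
  refine ⟨fun x => φ (u x), ?_, fun f hf => ?_⟩
  · refine summable_of_sum_le (c := ‖φ‖) (fun x => abs_nonneg _) fun s => ?_
    -- A signed sum of the indicators is bounded by 1 on `F`, so `‖φ‖` bounds every finite sum of
    -- `|φ (u x)|`.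
    have h1 := abs_apply_le_of_abs_le_on hφ (g := ∑ x ∈ s, (SignType.sign (φ (u x)) : ℝ) • u x)
      (ε := 1) zero_le_one (by
        intro y hy
        rw [hcomb s (fun x => (SignType.sign (φ (u x)) : ℝ)) y hy]
        split_ifs
        · rcases SignType.sign (φ (u y)) with _ | _ | _ <;> simp
        · simp)
    rw [happ s fun x => (SignType.sign (φ (u x)) : ℝ)] at h1
    simp only [sign_mul_self, mul_one] at h1
    exact (le_abs_self _).trans h1
  · have hlim : ∀ ε > 0, ∃ G : Finset K, ∀ s, G ⊆ s →
        |φ f - ∑ x ∈ s, φ (u x) * f x| ≤ ‖φ‖ * ε := by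
      intro ε hε
      have hfin : (F ∩ {x | ε ≤ |f x|}).Finite := by
        refine finite_of_disjoint_derivedSet (F := F) ?_ inter_subset_left ?_
        · exact (hF.inter (isClosed_le continuous_const (by fun_prop))).isCompact
        · rintro x ⟨-, hx⟩ hxd
          have hx' : ε ≤ |f x| := hx
          rw [hf x hxd, abs_zero] at hx'
          linarith
      refine ⟨hfin.toFinset, fun s hs => ?_⟩
      have := abs_apply_le_of_abs_le_on hφ (g := f - ∑ x ∈ s, f x • u x) hε.le (by
        intro y hy
        rw [ContinuousMap.sub_apply, hcomb s f y hy]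
        split_ifs with h
        · simpa using hε.le
        · rw [sub_zero]
          by_contra! hlt
          have hys : y ∈ s := hs (hfin.mem_toFinset.mpr ⟨hy, hlt.le⟩)
          have hyd : y ∈ derivedSet F := by_contra fun hd => h ⟨hys, hd⟩
          rw [hf y hyd, abs_zero] at hlt
          linarith)
      rw [map_sub, happ s f] at this
      simpa only [mul_comm] using this
    rw [HasSum, SummationFilter.unconditional_filter, Metric.tendsto_atTop]
    intro δ hδ
    obtain ⟨G, hG⟩ := hlim (δ / (‖φ‖ + 1)) (by positivity)
    refine ⟨G, fun s hs => ?_⟩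
    rw [dist_comm, Real.dist_eq]
    refine (hG s hs).trans_lt ?_
    rw [mul_div_assoc', div_lt_iff₀ (by positivity)]
    nlinarith [norm_nonneg φ]

theorem summable_mul_continuousMap {a : K → ℝ} (ha : Summable fun x => |a x|) (f : C(K, ℝ)) :
    Summable fun x => a x * f x := by
  refine Summable.of_norm_bounded (ha.mul_right ‖f‖) fun x => ?_
  rw [norm_mul, Real.norm_eq_abs]
  exact mul_le_mul_of_nonneg_left (f.norm_coe_le_norm x) (abs_nonneg _)

/-- The functional on `C(K, ℝ)` given by a summable family of point masses. -/
noncomputable def atomicFunctional (a : K → ℝ) (ha : Summable fun x => |a x|) :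
    C(K, ℝ) →L[ℝ] ℝ :=
  LinearMap.mkContinuous
    { toFun := fun f => ∑' x, a x * f x
      map_add' := fun f g => by
        rw [← (summable_mul_continuousMap ha f).tsum_add (summable_mul_continuousMap ha g)]
        simp [mul_add]
      map_smul' := fun c f => by
        rw [RingHom.id_apply, smul_eq_mul, ← tsum_mul_left]
        simp [mul_left_comm] }
    (∑' x, |a x|) fun f => by
      have hs : Summable fun x => ‖a x * f x‖ := (summable_mul_continuousMap ha f).norm
      refine (norm_tsum_le_tsum_norm hs).trans ?_
      rw [← tsum_mul_right]
      refine hs.tsum_le_tsum (fun x => ?_) (ha.mul_right _)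
      rw [norm_mul, Real.norm_eq_abs]
      exact mul_le_mul_of_nonneg_left (f.norm_coe_le_norm x) (abs_nonneg _)

theorem hasSum_atomicFunctional (a : K → ℝ) (ha : Summable fun x => |a x|) (f : C(K, ℝ)) :
    HasSum (fun x => a x * f x) (atomicFunctional a ha f) :=
  (summable_mul_continuousMap ha f).hasSum

/-- Every functional on `C(K, ℝ)` is atomic if `K` is scattered of finite height. -/
theorem IsFiniteDerivedSequence.exists_hasSum [T2Space K] {F : ℕ → Set K} {N : ℕ}
    (hF : IsFiniteDerivedSequence F N) (φ : C(K, ℝ) →L[ℝ] ℝ) :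
    ∃ a : K → ℝ, Summable (fun x => |a x|) ∧ ∀ f : C(K, ℝ), HasSum (fun x => a x * f x) (φ f) := by
  have key : ∀ n, ∃ a : K → ℝ, Summable (fun x => |a x|) ∧
      ∀ f : C(K, ℝ), (∀ x ∈ F n, f x = 0) → HasSum (fun x => a x * f x) (φ f) := by
    intro n
    induction n with
    | zero =>
      refine ⟨0, by simp, fun f hf => ?_⟩
      have : f = 0 := ContinuousMap.ext fun x => hf x (by rw [hF.zero]; exact mem_univ x)
      subst this
      simp
    | succ n ih =>
      obtain ⟨a, ha, haf⟩ := ih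
      -- Subtracting the atoms already found leaves a functional that kills the functions vanishing
      -- on `F n`.
      obtain ⟨b, hb, hbf⟩ := exists_hasSum_of_vanishing (hF.closed n)
        (φ := φ - atomicFunctional a ha) fun f hf => by
          rw [sub_apply, sub_eq_zero]
          exact (haf f hf).unique (hasSum_atomicFunctional a ha f)
      refine ⟨fun x => a x + b x, (ha.add hb).of_nonneg_of_le (fun _ => abs_nonneg _)
        fun x => abs_add_le _ _, fun f hf => ?_⟩
      rw [hF.succ] at hf
      simpa [add_mul] using (hasSum_atomicFunctional a ha f).add (hbf f hf)
  obtain ⟨a, ha, haf⟩ := key N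
  exact ⟨a, ha, fun f => haf f (by simp [hF.last])⟩

theorem IsFiniteDerivedSequence.exists_tsum_nat [T2Space K] [Nonempty K] {F : ℕ → Set K} {N : ℕ}
    (hF : IsFiniteDerivedSequence F N) (φ : C(K, ℝ) →L[ℝ] ℝ) :
    ∃ (b : ℕ → ℝ) (x : ℕ → K), ∀ f : C(K, ℝ), φ f = ∑' k, b k * f (x k) := by
  obtain ⟨a, ha, haf⟩ := hF.exists_hasSum φ
  have hcount : (Function.support a).Countable := ha.of_abs.countable_support
  have := hcount.to_subtype
  obtain ⟨i, hi⟩ := exists_injective_nat (Function.support a)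
  obtain ⟨x₀⟩ := ‹Nonempty K›
  refine ⟨Function.extend i (fun y => a y) 0, Function.extend i (fun y => (y : K)) fun _ => x₀,
    fun f => ?_⟩
  rw [← (haf f).tsum_eq, ← hi.tsum_eq, ← tsum_subtype_eq_of_support_subset (s := Function.support a)]
  · exact tsum_congr fun y => by rw [hi.extend_apply, hi.extend_apply]
  · intro y hy h0
    exact hy (by simp [h0])
  · intro k hk
    by_contra h
    exact hk (by simp [Function.extend_apply' _ _ _ h])

open Cardinal in
/-- Continuum many continuous functions on a compact scattered space of finite height identify all
but continuum many points. -/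
theorem IsFiniteDerivedSequence.mk_range_eval_le {F : ℕ → Set K} {N : ℕ}
    (hF : IsFiniteDerivedSequence F N) {ι : Type} (hι : #ι ≤ 𝔠) (f : ι → C(K, ℝ)) :
    #(range fun (x : K) (i : ι) => f i x) ≤ 𝔠 := by
  set π : K → ι → ℝ := fun x i => f i x with hπ
  let box : Finset (ι × ℚ × ℚ) → Set K := fun W =>
    ⋂ w ∈ W, {x | (w.2.1 : ℝ) ≤ f w.1 x ∧ f w.1 x ≤ w.2.2}
  have hbox : ∀ W, IsClosed (box W) := fun W => isClosed_biInter fun w _ =>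
    isClosed_Icc.preimage (f w.1).continuous
  -- A level and a rational box meeting that level in a finite set. There are at most `𝔠` such
  -- pairs, and their finite traces cover all patterns.
  let I := {q : ℕ × Finset (ι × ℚ × ℚ) // (F q.1 ∩ box q.2).Finite}
  have hI : #I ≤ 𝔠 := by
    refine (mk_subtype_le _).trans ?_
    rw [mk_prod, lift_id, lift_id]
    refine mul_le_of_le aleph0_le_continuum (by simp [aleph0_le_continuum]) ?_
    have h1 : #(ι × ℚ × ℚ) ≤ 𝔠 := by
      rw [mk_prod, lift_id, lift_id]
      exact mul_le_of_le aleph0_le_continuum hι (mk_le_aleph0.trans aleph0_le_continuum)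
    rcases finite_or_infinite (ι × ℚ × ℚ) with h | h
    · exact (mk_le_aleph0).trans aleph0_le_continuum
    · rw [mk_finset_of_infinite]
      exact h1
  have hcover : range π ⊆ ⋃ q : I, π '' (F q.1.1 ∩ box q.1.2) := by
    rintro _ ⟨x, rfl⟩
    have hex : ∃ n, π x ∉ π '' F n := ⟨N, by simp [hF.last]⟩
    classical
    -- At a level where the pattern of `x` occurs but not at the next, compactness of `F (n + 1)`
    -- gives a box around the pattern that misses `F (n + 1)`, so it meets `F n` in finitely many
    -- points.
    obtain ⟨n, hn, hn1⟩ : ∃ n, π x ∈ π '' F n ∧ π x ∉ π '' F (n + 1) := by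
      by_contra h
      push Not at h
      obtain ⟨m, hm⟩ := hex
      have : ∀ n, π x ∈ π '' F n := fun n => by
        induction n with
        | zero => exact mem_image_of_mem _ (by rw [hF.zero]; exact mem_univ x)
        | succ n ih => exact h n ih
      exact hm (this m)
    obtain ⟨z, hz, hzx⟩ := hn
    have hsep : ∀ y ∈ F (n + 1), ∃ w : ι × ℚ × ℚ, ((w.2.1 : ℝ) ≤ f w.1 x ∧ f w.1 x ≤ w.2.2) ∧
        ¬ ((w.2.1 : ℝ) ≤ f w.1 y ∧ f w.1 y ≤ w.2.2) := by
      intro y hy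
      have hne : π y ≠ π x := fun h => hn1 ⟨y, hy, h⟩
      obtain ⟨i, hi⟩ := Function.ne_iff.mp hne
      have hi' : f i y ≠ f i x := hi
      obtain ⟨l, hl⟩ := exists_rat_lt (f i x)
      obtain ⟨r, hr⟩ := exists_rat_gt (f i x)
      rcases lt_or_gt_of_ne hi' with h | h
      · obtain ⟨q, h1, h2⟩ := exists_rat_btwn h
        exact ⟨(i, q, r), ⟨h2.le, hr.le⟩, fun h' => absurd h'.1 (not_le.mpr h1)⟩
      · obtain ⟨q, h1, h2⟩ := exists_rat_btwn h
        exact ⟨(i, l, q), ⟨hl.le, h1.le⟩, fun h' => absurd h'.2 (not_le.mpr h2)⟩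
    let U : {w : ι × ℚ × ℚ // (w.2.1 : ℝ) ≤ f w.1 x ∧ f w.1 x ≤ w.2.2} → Set K := fun w =>
      {y | (w.1.2.1 : ℝ) ≤ f w.1.1 y ∧ f w.1.1 y ≤ w.1.2.2}ᶜ
    obtain ⟨t, ht⟩ := (hF.closed (n + 1)).isCompact.elim_finite_subcover U
      (fun w => (isClosed_Icc.preimage (f w.1.1).continuous).isOpen_compl)
      (fun y hy => by
        obtain ⟨w, hw, hwy⟩ := hsep y hy
        exact mem_iUnion.mpr ⟨⟨w, hw⟩, hwy⟩)
    set W : Finset (ι × ℚ × ℚ) := t.map (Function.Embedding.subtype _) with hW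
    have hfin : (F n ∩ box W).Finite := by
      refine finite_of_disjoint_derivedSet (F := F n) ((hF.closed n).inter (hbox W)).isCompact
        inter_subset_left fun y hy hyd => ?_
      rw [← hF.succ] at hyd
      obtain ⟨w, hw, hyw⟩ := mem_iUnion₂.mp (ht hyd)
      exact hyw (mem_iInter₂.mp hy.2 w.1 (Finset.mem_map_of_mem _ hw))
    refine mem_iUnion.mpr ⟨⟨(n, W), hfin⟩, z, ⟨hz, mem_iInter₂.mpr fun w hw => ?_⟩, hzx⟩
    obtain ⟨w', hw', rfl⟩ := Finset.mem_map.mp hw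
    have := congrFun hzx w'.1.1
    simp only [hπ] at this
    simpa [this] using w'.2
  refine (mk_le_mk_of_subset hcover).trans ?_
  refine (mk_iUnion_le_sum_mk).trans ?_
  refine (sum_le_mk_mul_iSup _).trans ?_
  refine mul_le_of_le aleph0_le_continuum hI (ciSup_le' fun q => ?_)
  exact ((q.2.image π).countable.le_aleph0).trans aleph0_le_continuum

end Functionals

/-- The codes of the finite initial segments of a binary sequence. -/
def branchCodes (x : ℕ → Bool) : Set ℕ :=
  range fun n => Encodable.encode (List.ofFn fun i : Fin n => x i)

theorem infinite_branchCodes (x : ℕ → Bool) : (branchCodes x).Infinite := by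
  refine infinite_range_of_injective fun n m h => ?_
  simpa using congrArg List.length (Encodable.encode_injective h)

theorem finite_branchCodes_inter {x y : ℕ → Bool} (h : x ≠ y) :
    (branchCodes x ∩ branchCodes y).Finite := by
  obtain ⟨k, hk⟩ := Function.ne_iff.mp h
  refine ((finite_Iic k).image fun n => Encodable.encode (List.ofFn fun i : Fin n => x i)).subset ?_
  rintro _ ⟨⟨n, rfl⟩, ⟨m, hm⟩⟩
  refine mem_image_of_mem _ (mem_Iic.mpr ?_)
  by_contra! hkn
  have he : (List.ofFn fun i : Fin m => y i) = List.ofFn fun i : Fin n => x i :=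
    Encodable.encode_injective hm
  obtain rfl : m = n := by simpa using congrArg List.length he
  exact hk (congrFun (List.ofFn_injective he) ⟨k, hkn⟩).symm

/-! ### Gluing along an almost disjoint family -/

section AlmostDisjoint

variable {ι : Type*} {A : ι → Set ℕ} {S : Set ι}

/-- The sequence `v` is asymptotically equal to `g α` on `A α` for each `α ∈ S`, and is
asymptotically small off finite unions of these sets. -/
def IsGluing (A : ι → Set ℕ) (S : Set ι) (g : ι → ℝ) (v : ℕ → ℝ) : Prop :=
  (∀ α ∈ S, Tendsto v (cofinite ⊓ 𝓟 (A α)) (𝓝 (g α))) ∧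
    ∀ ε > 0, ∃ G : Finset ι, (G : Set ι) ⊆ S ∧
      ∀ᶠ n in cofinite, (∀ α ∈ G, n ∉ A α) → |v n| ≤ ε

theorem IsGluing.add {g g' : ι → ℝ} {v v' : ℕ → ℝ} (h : IsGluing A S g v)
    (h' : IsGluing A S g' v') : IsGluing A S (g + g') (v + v') := by
  classical
  refine ⟨fun α hα => (h.1 α hα).add (h'.1 α hα), fun ε hε => ?_⟩
  obtain ⟨G, hG, hv⟩ := h.2 (ε / 2) (by positivity)
  obtain ⟨G', hG', hv'⟩ := h'.2 (ε / 2) (by positivity)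
  refine ⟨G ∪ G', by simp [hG, hG'], ?_⟩
  filter_upwards [hv, hv'] with n hn hn' hout
  have h1 := hn fun α hα => hout α (Finset.mem_union_left _ hα)
  have h2 := hn' fun α hα => hout α (Finset.mem_union_right _ hα)
  exact (abs_add_le _ _).trans (by linarith)

theorem IsGluing.smul {g : ι → ℝ} {v : ℕ → ℝ} (h : IsGluing A S g v) (c : ℝ) :
    IsGluing A S (c • g) (c • v) := by
  refine ⟨fun α hα => (h.1 α hα).const_mul c, fun ε hε => ?_⟩
  obtain ⟨G, hG, hv⟩ := h.2 (ε / (|c| + 1)) (by positivity)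
  refine ⟨G, hG, ?_⟩
  filter_upwards [hv] with n hn hout
  have h1 := hn hout
  rw [le_div_iff₀ (by positivity)] at h1
  rw [Pi.smul_apply, smul_eq_mul, abs_mul]
  nlinarith [abs_nonneg (v n), abs_nonneg c]

theorem isGluing_zero_of_tendsto {v : ℕ → ℝ} (hv : Tendsto v cofinite (𝓝 0)) :
    IsGluing A S 0 v := by
  refine ⟨fun α _ => hv.mono_left inf_le_left, fun ε hε => ⟨∅, by simp, ?_⟩⟩
  filter_upwards [Metric.tendsto_nhds.mp hv ε hε] with n hn _
  simpa using hn.le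

theorem IsGluing.tendsto_zero {g : ι → ℝ} {v : ℕ → ℝ} (h : IsGluing A S g v)
    (hg : ∀ α ∈ S, g α = 0) : Tendsto v cofinite (𝓝 0) := by
  rw [Metric.tendsto_nhds]
  intro ε hε
  obtain ⟨G, hG, hv⟩ := h.2 (ε / 2) (by positivity)
  have hA : ∀ᶠ n in cofinite, ∀ α ∈ G, n ∈ A α → |v n| < ε := by
    rw [Finset.eventually_all]
    intro α hα
    have := Metric.tendsto_nhds.mp (h.1 α (hG hα)) ε hε
    rw [hg α (hG hα), eventually_inf_principal] at this
    simpa using this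
  filter_upwards [hv, hA] with n hn hn'
  rw [dist_zero_right, Real.norm_eq_abs]
  by_cases hout : ∀ α ∈ G, n ∉ A α
  · linarith [hn hout]
  · push Not at hout
    obtain ⟨α, hα, hnα⟩ := hout
    exact hn' α hα hnα

theorem isGluing_of_approx {g : ι → ℝ} {v : ℕ → ℝ}
    (h : ∀ ε > 0, ∃ g' v', IsGluing A S g' v' ∧ (∀ α, |g α - g' α| ≤ ε) ∧ ∀ n, |v n - v' n| ≤ ε) :
    IsGluing A S g v := by
  constructor
  · intro α hα
    rw [Metric.tendsto_nhds]
    intro ε hε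
    obtain ⟨g', v', h', hg, hv⟩ := h (ε / 4) (by positivity)
    filter_upwards [Metric.tendsto_nhds.mp (h'.1 α hα) (ε / 4) (by positivity)] with n hn
    rw [Real.dist_eq, abs_lt] at *
    have h1 := abs_le.mp (hg α)
    have h2 := abs_le.mp (hv n)
    constructor <;> linarith
  · intro ε hε
    obtain ⟨g', v', h', -, hv⟩ := h (ε / 2) (by positivity)
    obtain ⟨G, hG, hv'⟩ := h'.2 (ε / 2) (by positivity)
    refine ⟨G, hG, ?_⟩
    filter_upwards [hv'] with n hn hout
    have h1 := abs_le.mp (hn hout)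
    have h2 := abs_le.mp (hv n)
    rw [abs_le]
    constructor <;> linarith

/-- Every family vanishing at infinity can be glued along an almost disjoint family of sets. -/
theorem exists_isGluing (hA : ∀ α β, α ≠ β → (A α ∩ A β).Finite) (S : Set ι) {g : ι → ℝ}
    (hg : ∀ ε > 0, {α | ε ≤ |g α|}.Finite) {M : ℝ} (hM : 0 ≤ M) (hgM : ∀ α, |g α| ≤ M) :
    ∃ v : ℕ → ℝ, IsGluing A S g v ∧ ∀ n, |v n| ≤ M := by
  classical
  -- `v n` is a value `g α` of largest modulus among the `α ∈ S` with `n ∈ A α`, or 0 if all these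
  -- values vanish.
  have hsel : ∀ n, ∃ t : ℝ, (t = 0 ∧ ∀ α ∈ S, n ∈ A α → g α = 0) ∨
      ∃ α ∈ S, n ∈ A α ∧ t = g α ∧ ∀ β ∈ S, n ∈ A β → |g β| ≤ |g α| := by
    intro n
    by_cases h0 : ∀ α ∈ S, n ∈ A α → g α = 0
    · exact ⟨0, Or.inl ⟨rfl, h0⟩⟩
    · push Not at h0
      obtain ⟨α, hα, hn, hne⟩ := h0
      have hfin : ({β | |g α| ≤ |g β|} ∩ {β | β ∈ S ∧ n ∈ A β}).Finite :=
        (hg _ (abs_pos.mpr hne)).inter_of_left _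
      obtain ⟨γ, hγ, hmax⟩ := exists_max_image _ (fun β => |g β|) hfin ⟨α, le_refl |g α|, hα, hn⟩
      refine ⟨g γ, Or.inr ⟨γ, hγ.2.1, hγ.2.2, rfl, fun β hβ hnβ => ?_⟩⟩
      by_cases hle : |g α| ≤ |g β|
      · exact hmax β ⟨hle, hβ, hnβ⟩
      · exact (not_le.mp hle).le.trans hγ.1
  choose v hv using hsel
  refine ⟨v, ⟨fun α hα => ?_, fun ε hε => ?_⟩, fun n => ?_⟩
  · rw [Metric.tendsto_nhds]
    intro ε hε
    have hfin := hg (ε / 2) (by positivity)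
    -- Only finitely many `β` have `|g β| ≥ ε / 2`, so almost every `n ∈ A α` avoids their sets when
    -- `β ≠ α`.
    have hev : ∀ᶠ n in cofinite, ∀ β ∈ hfin.toFinset, β ≠ α → ¬ (n ∈ A α ∩ A β) := by
      rw [Finset.eventually_all]
      intro β _
      by_cases hβ : β = α
      · simp [hβ]
      · filter_upwards [(hA α β (Ne.symm hβ)).compl_mem_cofinite] with n hn _
        exact hn
    rw [eventually_inf_principal]
    filter_upwards [hev] with n hn hnα
    rcases hv n with ⟨h0, hz⟩ | ⟨β, -, hnβ, hvβ, hmax⟩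
    · rw [h0, hz α hα hnα, dist_self]
      exact hε
    · by_cases hβ : β = α
      · rw [hvβ, hβ, dist_self]
        exact hε
      · have hβs : |g β| < ε / 2 := by
          by_contra! hle
          exact hn β (hfin.mem_toFinset.mpr hle) hβ ⟨hnα, hnβ⟩
        have hαs := hmax α hα hnα
        rw [hvβ, Real.dist_eq]
        exact (abs_sub _ _).trans_lt (by linarith)
  · have hfin := (hg ε hε).inter_of_left S
    refine ⟨hfin.toFinset, by simp, Eventually.of_forall fun n hn => ?_⟩
    rcases hv n with ⟨h0, -⟩ | ⟨β, hβ, hnβ, hvβ, -⟩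
    · rw [h0, abs_zero]
      exact hε.le
    · rw [hvβ]
      by_contra! hlt
      exact hn β (hfin.mem_toFinset.mpr ⟨hlt.le, hβ⟩) hnβ
  · rcases hv n with ⟨h0, -⟩ | ⟨β, -, -, hvβ, -⟩
    · rwa [h0, abs_zero]
    · rw [hvβ]
      exact hgM β

end AlmostDisjoint

open scoped BoundedContinuousFunction

/-! ### The twisted sum attached to a subset of the index set -/

section Gluing

variable {ι : Type*} {K : Type*} [TopologicalSpace K]

/-- The pairs `(f, v)` such that `v` glues the numbers `f (z α) - f p`. -/
def gluingSpace (A : ι → Set ℕ) (S : Set ι) (p : K) (z : ι → K) :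
    Submodule ℝ (C(K, ℝ) × (ℕ →ᵇ ℝ)) where
  carrier := {w | IsGluing A S (fun α => w.1 (z α) - w.1 p) w.2}
  zero_mem' := by
    have := isGluing_zero_of_tendsto (A := A) (S := S) (v := 0) tendsto_const_nhds
    change IsGluing A S (fun α => (0 : C(K, ℝ)) (z α) - (0 : C(K, ℝ)) p) 0
    convert this using 1
    ext α
    simp
  add_mem' {w w'} h h' := by
    have := IsGluing.add h h'
    change IsGluing A S (fun α => (w + w').1 (z α) - (w + w').1 p) (w.2 + w'.2)
    convert this using 1
    ext α
    simp only [Prod.fst_add, ContinuousMap.add_apply, Pi.add_apply]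
    ring
  smul_mem' c w h := by
    have := IsGluing.smul h c
    change IsGluing A S (fun α => (c • w).1 (z α) - (c • w).1 p) (c • ⇑w.2)
    convert this using 1
    ext α
    simp only [Prod.smul_fst, ContinuousMap.smul_apply, Pi.smul_apply, smul_eq_mul]
    ring

variable {A : ι → Set ℕ} {S : Set ι} {p : K} {z : ι → K}

theorem mem_gluingSpace {w : C(K, ℝ) × (ℕ →ᵇ ℝ)} :
    w ∈ gluingSpace A S p z ↔ IsGluing A S (fun α => w.1 (z α) - w.1 p) w.2 := Iff.rfl

theorem isClosed_gluingSpace [CompactSpace K] :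
    IsClosed (gluingSpace A S p z : Set (C(K, ℝ) × (ℕ →ᵇ ℝ))) := by
  refine isClosed_of_closure_subset fun w hw => ?_
  refine isGluing_of_approx fun ε hε => ?_
  obtain ⟨w', hw', hd⟩ := Metric.mem_closure_iff.mp hw (ε / 2) (by positivity)
  rw [dist_eq_norm] at hd
  have h1 : ∀ x, |w.1 x - w'.1 x| ≤ ε / 2 := fun x =>
    (((w - w').1).norm_coe_le_norm x).trans ((norm_fst_le (w - w')).trans hd.le)
  have h2 : ∀ n, |w.2 n - w'.2 n| ≤ ε / 2 := fun n =>
    (((w - w').2).norm_coe_le_norm n).trans ((norm_snd_le (w - w')).trans hd.le)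
  refine ⟨_, _, hw', fun α => ?_, fun n => (h2 n).trans (by linarith)⟩
  have ha := abs_le.mp (h1 (z α))
  have hb := abs_le.mp (h1 p)
  rw [abs_le]
  constructor <;> linarith

/-- The gluing space as a normed space. -/
def GluingSpace (A : ι → Set ℕ) (S : Set ι) (p : K) (z : ι → K) : Type _ :=
  gluingSpace A S p z

noncomputable instance [CompactSpace K] : NormedAddCommGroup (GluingSpace A S p z) :=
  inferInstanceAs (NormedAddCommGroup (gluingSpace A S p z))

noncomputable instance [CompactSpace K] : NormedSpace ℝ (GluingSpace A S p z) :=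
  inferInstanceAs (NormedSpace ℝ (gluingSpace A S p z))

instance [CompactSpace K] : CompleteSpace (GluingSpace A S p z) :=
  (isClosed_gluingSpace (A := A) (S := S) (p := p) (z := z)).completeSpace_coe

variable [CompactSpace K]

theorem norm_gluingSpace (w : GluingSpace A S p z) : ‖w‖ = max ‖w.1.1‖ ‖w.1.2‖ := rfl

/-- The inclusion of the null sequences into the gluing space. -/
noncomputable def gluingInclusion (A : ι → Set ℕ) (S : Set ι) (p : K) (z : ι → K) :
    SeqC0 →L[ℝ] GluingSpace A S p z :=
  LinearMap.mkContinuous (σ := RingHom.id ℝ) (E := SeqC0) (F := GluingSpace A S p z)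
    { toFun := fun c => ⟨(0, c.toBCF), by
        have := isGluing_zero_of_tendsto (A := A) (S := S) (v := c)
          (cocompact_eq_cofinite ℕ ▸ c.zero_at_infty')
        rw [mem_gluingSpace]
        change IsGluing A S (fun α => (0 : C(K, ℝ)) (z α) - (0 : C(K, ℝ)) p) c
        convert this using 1
        ext α
        simp⟩
      map_add' := fun c c' => Subtype.ext (Prod.ext (add_zero (0 : C(K, ℝ))).symm rfl)
      map_smul' := fun c c' => Subtype.ext (Prod.ext (smul_zero c : c • (0 : C(K, ℝ)) = 0).symm rfl) }
    1 fun c => by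
      rw [one_mul, norm_gluingSpace]
      refine max_le ?_ (le_of_eq rfl)
      change ‖(0 : C(K, ℝ))‖ ≤ _
      simp

theorem gluingInclusion_fst (c : SeqC0) : (gluingInclusion A S p z c).1.1 = 0 := rfl

/-- The projection of the gluing space onto the first coordinate. -/
noncomputable def gluingProjection (A : ι → Set ℕ) (S : Set ι) (p : K) (z : ι → K) :
    GluingSpace A S p z →L[ℝ] C(K, ℝ) :=
  LinearMap.mkContinuous (σ := RingHom.id ℝ) (E := GluingSpace A S p z) (F := C(K, ℝ))
    { toFun := fun w => w.1.1
      map_add' := fun _ _ => rfl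
      map_smul' := fun _ _ => rfl }
    1 fun w => by
      rw [one_mul, norm_gluingSpace]
      exact le_max_left _ _

theorem gluingProjection_apply (w : GluingSpace A S p z) :
    gluingProjection A S p z w = w.1.1 := rfl

/-- The lift need not be linear in `f`; its bound later makes the functionals from a splitting
continuous. -/
theorem exists_bounded_lift (hA : ∀ α β, α ≠ β → (A α ∩ A β).Finite)
    (hz : ∀ f : C(K, ℝ), ∀ ε > 0, {α | ε ≤ |f (z α) - f p|}.Finite) (f : C(K, ℝ)) :
    ∃ w : GluingSpace A S p z, gluingProjection A S p z w = f ∧ ‖w‖ ≤ 2 * ‖f‖ := by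
  obtain ⟨v, hv, hvM⟩ := exists_isGluing hA S (hz f) (M := 2 * ‖f‖) (by positivity) fun α => by
    have h1 := f.norm_coe_le_norm (z α)
    have h2 := f.norm_coe_le_norm p
    rw [Real.norm_eq_abs] at h1 h2
    exact (abs_sub _ _).trans (by linarith)
  refine ⟨⟨(f, BoundedContinuousFunction.ofNormedAddCommGroup v continuous_of_discreteTopology
    (2 * ‖f‖) hvM), hv⟩, rfl, ?_⟩
  refine (norm_gluingSpace (A := A) (S := S) (p := p) (z := z) _).trans_le (max_le ?_ ?_)
  · change ‖f‖ ≤ _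
    linarith [norm_nonneg f]
  · exact BoundedContinuousFunction.norm_ofNormedAddCommGroup_le _ (by positivity) hvM

theorem isTwistedSum_gluing (hA : ∀ α β, α ≠ β → (A α ∩ A β).Finite)
    (hz : ∀ f : C(K, ℝ), ∀ ε > 0, {α | ε ≤ |f (z α) - f p|}.Finite) :
    IsTwistedSum (gluingInclusion A S p z)
      (gluingProjection A S p z) where
  injective := by
    intro c c' h
    have h2 : c.toBCF = c'.toBCF := congrArg (fun w : GluingSpace A S p z => w.1.2) h
    exact ZeroAtInftyContinuousMap.toBCF_injective _ _ h2
  exact := by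
    intro w
    constructor
    · intro h
      rw [gluingProjection_apply] at h
      have hlim : Tendsto w.1.2 cofinite (𝓝 0) :=
        IsGluing.tendsto_zero w.2 fun α _ => by simp [h]
      refine ⟨⟨⟨w.1.2, w.1.2.continuous⟩, (cocompact_eq_cofinite ℕ).symm ▸ hlim⟩, ?_⟩
      refine Subtype.ext (Prod.ext h.symm ?_)
      ext n
      rfl
    · rintro ⟨c, rfl⟩
      exact gluingInclusion_fst (A := A) (S := S) (p := p) (z := z) c
  surjective := fun f => by
    obtain ⟨w, hw, -⟩ := exists_bounded_lift (S := S) hA hz f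
    exact ⟨w, hw⟩

/-- A splitting of the gluing sequence gives functionals on `C(K, ℝ)` whose values glue. -/
theorem exists_functionals_of_isSplit (hA : ∀ α β, α ≠ β → (A α ∩ A β).Finite)
    (hz : ∀ f : C(K, ℝ), ∀ ε > 0, {α | ε ≤ |f (z α) - f p|}.Finite)
    (h : IsSplitTwistedSum (gluingInclusion A S p z)) :
    ∃ φ : ℕ → C(K, ℝ) →L[ℝ] ℝ, ∀ f, IsGluing A S (fun α => f (z α) - f p) fun n => φ n f := by
  obtain ⟨r, hr⟩ := h
  set i := gluingInclusion A S p z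
  set q := gluingProjection A S p z
  have hT : IsTwistedSum i q := isTwistedSum_gluing hA hz
  -- `D` kills the range of `i`, so `D w` depends only on `q w`. Hence `f ↦ D (Ω f)` is linear
  -- although `Ω` need not be.
  set D : GluingSpace A S p z →L[ℝ] GluingSpace A S p z := ContinuousLinearMap.id ℝ _ - i.comp r
  have hD : ∀ w w', q w = q w' → D w = D w' := by
    intro w w' hw
    obtain ⟨c, hc⟩ := (hT.exact (w - w')).mp (by rw [map_sub, hw, sub_self])
    rw [← sub_eq_zero, ← map_sub, ← hc]
    have : r (i c) = c := DFunLike.congr_fun hr c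
    simp [D, this]
  have hqD : ∀ w, q (D w) = q w := by
    intro w
    simp [D, hT.exact.apply_apply_eq_zero]
  choose Ω hΩ hΩn using exists_bounded_lift (S := S) hA hz
  let φ : ℕ → C(K, ℝ) →L[ℝ] ℝ := fun n => LinearMap.mkContinuous
    { toFun := fun f => (D (Ω f)).1.2 n
      map_add' := fun f g => by
        rw [hD (Ω (f + g)) (Ω f + Ω g) (by rw [map_add, hΩ, hΩ, hΩ]), map_add]
        rfl
      map_smul' := fun c f => by
        rw [hD (Ω (c • f)) (c • Ω f) (by rw [map_smul, hΩ, hΩ]), map_smul]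
        rfl }
    (‖D‖ * 2) fun f => by
      refine ((D (Ω f)).1.2.norm_coe_le_norm n).trans ((norm_snd_le (D (Ω f)).1).trans ?_)
      refine (D.le_opNorm (Ω f)).trans ?_
      rw [mul_assoc]
      exact mul_le_mul_of_nonneg_left (hΩn f) (norm_nonneg _)
  refine ⟨φ, fun f => ?_⟩
  have hf : (D (Ω f)).1.1 = f := (hqD (Ω f)).trans (hΩ f)
  have := (D (Ω f)).2
  rw [mem_gluingSpace, hf] at this
  exact this

end Gluing

/-! ### Counting splittings -/

open Cardinal in
/-- If all gluing sequences along an almost disjoint family split, then there are at most continuum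
many subsets of the index set. -/
theorem IsFiniteDerivedSequence.exists_not_isSplit {K : Type*} [TopologicalSpace K]
    [CompactSpace K] [T2Space K] {F : ℕ → Set K} {N : ℕ} (hF : IsFiniteDerivedSequence F N)
    {ι : Type} (hι : #ι = 𝔠) {A : ι → Set ℕ} (hAinf : ∀ α, (A α).Infinite)
    (hA : ∀ α β, α ≠ β → (A α ∩ A β).Finite) {p : K} {z : ι → K}
    (hz : ∀ f : C(K, ℝ), ∀ ε > 0, {α | ε ≤ |f (z α) - f p|}.Finite)
    (f : ι → C(K, ℝ)) (hfp : ∀ α, f α p = 0) (hf1 : ∀ α, f α (z α) = 1)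
    (hf0 : ∀ α β, β ≠ α → f α (z β) = 0) :
    ∃ S : Set ι, ¬ IsSplitTwistedSum (gluingInclusion A S p z) := by
  by_contra! hall
  have : Nonempty K := ⟨p⟩
  choose φ hφ using fun S => exists_functionals_of_isSplit hA hz (hall S)
  choose b x hbx using fun S n => hF.exists_tsum_nat (φ S n)
  let R := range fun (y : K) (i : ι) => f i y
  -- Each atom is recorded by its mass and the pattern of its point, not the point itself, since `K`
  -- may have more than `𝔠` points.
  let code : Set ι → ℕ → ℕ → ℝ × R := fun S n k => (b S n k, ⟨_, mem_range_self (x S n k)⟩)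
  have hrec : ∀ S α, α ∈ S ↔
      ¬ Tendsto (fun n => ∑' k, (code S n k).1 * (code S n k).2.1 α) cofinite (𝓝 0) := by
    intro S α
    have hval : (fun n => ∑' k, (code S n k).1 * (code S n k).2.1 α) = fun n => φ S n (f α) :=
      funext fun n => (hbx S n (f α)).symm
    rw [hval]
    constructor
    · intro hα h0
      have h1 := (hφ S (f α)).1 α hα
      beta_reduce at h1
      rw [hf1, hfp, sub_zero] at h1
      have : (cofinite ⊓ 𝓟 (A α)).NeBot := cofinite_inf_principal_neBot_iff.mpr (hAinf α)
      exact zero_ne_one (tendsto_nhds_unique (h0.mono_left inf_le_left) h1)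
    · intro h
      by_contra hα
      refine h ((hφ S (f α)).tendsto_zero fun β hβ => ?_)
      rw [hf0 α β (fun h => hα (h ▸ hβ)), hfp, sub_zero]
  have hinj : Function.Injective code := by
    intro S T hST
    ext α
    rw [hrec S, hrec T, hST]
  have hR : #R ≤ 𝔠 := hF.mk_range_eval_le hι.le f
  have hprod : #(ℝ × R) ≤ 𝔠 := by
    rw [mk_prod, lift_id, lift_id]
    exact mul_le_of_le aleph0_le_continuum mk_real.le hR
  have hcode : #(ℕ → ℕ → ℝ × R) ≤ 𝔠 := by
    simp only [mk_pi, prod_const, lift_id, mk_nat]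
    calc (#(ℝ × R) ^ ℵ₀) ^ ℵ₀ ≤ (𝔠 ^ ℵ₀) ^ ℵ₀ := power_le_power_right (power_le_power_right hprod)
      _ = 𝔠 := by simp
  have := (mk_le_of_injective hinj).trans hcode
  rw [mk_set, hι] at this
  exact (cantor 𝔠).not_ge this

-- This is where CH enters: an uncountable set has at least `ℵ₁ = 𝔠` elements.
open Cardinal in
theorem exists_cantor_embedding (hCH : continuum.{0} = aleph 1) {K : Type u} {Z : Set K}
    (hZ : ¬ Z.Countable) : Nonempty ((ℕ → Bool) ↪ Z) := by
  rw [← lift_mk_le']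
  have h1 : #(ℕ → Bool) = 𝔠 := by simp
  rw [h1, hCH, lift_aleph, ← le_aleph0_iff_set_countable, not_le] at *
  simpa [← succ_aleph0] using hZ

theorem theorem8p4 (hCH : Cardinal.continuum.{0} = Cardinal.aleph 1)
    (K : Type u) [TopologicalSpace K] [CompactSpace K] [T2Space K]
    (hmet : ¬ TopologicalSpace.MetrizableSpace K)
    (hsc : IsScatteredSpace K)
    (hht : scatteredHeight K < Ordinal.omega0) :
    ∃ (X : Type u) (_ : NormedAddCommGroup X) (_ : NormedSpace ℝ X) (_ : CompleteSpace X)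
      (i : SeqC0 →L[ℝ] X) (q : X →L[ℝ] C(K, ℝ)),
      IsTwistedSum i q ∧ ¬ IsSplitTwistedSum i := by
  obtain ⟨F, N, hF⟩ := exists_isFiniteDerivedSequence hsc hht
  obtain ⟨p, Z, hZ, hpZ, hconv⟩ := hF.exists_uncountable_converging hsc hmet
  obtain ⟨e⟩ := exists_cantor_embedding hCH hZ
  set z : (ℕ → Bool) → K := fun α => e α with hzdef
  have hzinj : Function.Injective z := Subtype.val_injective.comp e.injective
  have hz : ∀ f : C(K, ℝ), ∀ ε > 0, {α | ε ≤ |f (z α) - f p|}.Finite := by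
    intro f ε hε
    have hfin := hconv {x | |f x - f p| < ε} (isOpen_lt (by fun_prop) continuous_const)
      (by simpa using hε)
    exact (hfin.preimage hzinj.injOn).subset fun α hα => ⟨(e α).2, fun h : |f (z α) - f p| < ε => absurd h (not_lt.mpr hα)⟩
  have hpeak : ∀ α, ∃ g : C(K, ℝ), g p = 0 ∧ g (z α) = 1 ∧ ∀ β, β ≠ α → g (z β) = 0 := by
    intro α
    obtain ⟨g, h0, h1, -⟩ := exists_continuous_zero_one_of_isClosed
      (isClosed_insert_of_converging hconv (W := Z \ {z α}) sdiff_subset)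
      (isClosed_singleton (x := z α)) (by
        rw [disjoint_singleton_right, mem_insert_iff, not_or]
        exact ⟨fun h => hpZ (h ▸ (e α).2), fun h => h.2 rfl⟩)
    exact ⟨g, h0 (mem_insert _ _), h1 rfl, fun β hβ =>
      h0 (mem_insert_of_mem _ ⟨(e β).2, fun h => hβ (hzinj h)⟩)⟩
  choose f hfp hf1 hf0 using hpeak
  have hA : ∀ α β, α ≠ β → (branchCodes α ∩ branchCodes β).Finite :=
    fun _ _ => finite_branchCodes_inter
  obtain ⟨S, hS⟩ := hF.exists_not_isSplit (by simp) infinite_branchCodes hA hz f hfp hf1 hf0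
  exact ⟨GluingSpace branchCodes S p z, inferInstance, inferInstance, inferInstance,
    gluingInclusion branchCodes S p z,
    gluingProjection branchCodes S p z, isTwistedSum_gluing hA hz, hS⟩
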